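/- A hypergraph $H$ consists of a finite vertex set $V(H)$ and a set $E(H)$ of subsets of $V(H)$, its hyperedges; its order is $|V(H)|$, and $H$ is $k$-uniform if every hyperedge has exactly $k$ elements. The distance $d_H(u,v)$ is the least $n$ for which there are vertices $u=x_0,x_1,\dots,x_n=v$ and hyperedges $e_1,\dots,e_n$ with $x_{i-1},x_i\in e_i$ for $1\le i\le n$ (and $d_H(u,v)=\infty$ if there are none); $H$ is connected if $V(H)\neq\emptyset$ and all distances are finite. The total distance (Wiener index) is $W(H)=\sum_{\{u,v\}\subseteq V(H),\,u\ne v} d_H(u,v)\in\mathbb{N}\cup\{\infty\}$. For $v\in V(H)$, $H\setminus v$ is the hypergraph with vertex set $V(H)\setminus\{v\}$ whose hyperedges are the hyperedges of $H$ that do not contain $v$. A connected hypergraph $H$ is a \v{S}olt\'es hypergraph if $W(H\setminus v)=W(H)$ for every $v\in V(H)$. **Theorem.** There is no $3$-uniform \v{S}olt\'es hypergraph of order $9$. -/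

import Mathlib

open scoped Hypergraph

namespace Hypergraph

universe u

variable {α : Type u}

/-- A hypergraph is `k`-uniform if each of its hyperedges has exactly `k` vertices. -/
def IsUniform (H : Hypergraph α) (k : ℕ) : Prop :=
  ∀ e ∈ E(H), e.encard = k

/-- The hypergraph `H ∖ v`: the vertex `v` is removed, together with all hyperedges
containing it. -/
def deleteVertex (H : Hypergraph α) (v : α) : Hypergraph α where
  vertexSet := V(H) \ {v}
  edgeSet := {e | e ∈ E(H) ∧ v ∉ e}
  subset_vertexSet_of_mem_edgeSet' := by
    rintro e ⟨he, hv⟩ x hx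
    refine ⟨mem_vertexSet_of_mem_edgeSet he hx, ?_⟩
    rintro rfl
    exact hv hx

/-- `H.HasWalk n u v`: there is a walk `u = x₀, e₁, x₁, …, eₙ, xₙ = v` in `H`, where each
hyperedge `eᵢ` contains both `xᵢ₋₁` and `xᵢ`. Its length is the number `n` of hyperedges. -/
inductive HasWalk (H : Hypergraph α) : ℕ → α → α → Prop
  | nil {u : α} (hu : u ∈ V(H)) : HasWalk H 0 u u
  | cons {n : ℕ} {u v w : α} {e : Set α} (he : e ∈ E(H)) (hu : u ∈ e) (hv : v ∈ e)
      (h : HasWalk H n v w) : HasWalk H (n + 1) u w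

/-- The distance between two vertices: the length of a shortest walk (equivalently, of a
shortest path) between them, and `⊤` if there is none. -/
noncomputable def edist (H : Hypergraph α) (u v : α) : ℕ∞ :=
  ⨅ (n : ℕ) (_ : H.HasWalk n u v), (n : ℕ∞)

/-- A hypergraph is connected if it has a vertex and any two vertices are joined by a walk. -/
def Connected (H : Hypergraph α) : Prop :=
  V(H).Nonempty ∧ ∀ u ∈ V(H), ∀ v ∈ V(H), ∃ n, H.HasWalk n u v

theorem HasWalk.snoc {H : Hypergraph α} {n : ℕ} {u v w : α} {e : Set α}
    (h : H.HasWalk n u v) (he : e ∈ E(H)) (hv : v ∈ e) (hw : w ∈ e) :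
    H.HasWalk (n + 1) u w := by
  induction h with
  | nil hu => exact .cons he hv hw (.nil (mem_vertexSet_of_mem_edgeSet he hw))
  | cons hf hu hx _ ih => exact .cons hf hu hx (ih hv)

theorem HasWalk.symm {H : Hypergraph α} {n : ℕ} {u v : α} (h : H.HasWalk n u v) :
    H.HasWalk n v u := by
  induction h with
  | nil hu => exact .nil hu
  | cons hf hu hx _ ih => exact ih.snoc hf hx hu

theorem edist_comm (H : Hypergraph α) (u v : α) : H.edist u v = H.edist v u := by
  have h : ∀ n, H.HasWalk n u v ↔ H.HasWalk n v u := fun n => ⟨.symm, .symm⟩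
  simp only [edist, h]

/-- The unordered pairs of distinct vertices of `H`. -/
def vertexPairs (H : Hypergraph α) : Set (Sym2 α) :=
  {p | ¬ p.IsDiag ∧ ∀ x ∈ p, x ∈ V(H)}

/-- The total distance (Wiener index) `W(H)`: the sum of the distances over all unordered pairs
of distinct vertices. It is `⊤` as soon as two vertices are not joined by a walk. -/
noncomputable def wienerIndex (H : Hypergraph α) : ℕ∞ :=
  ∑' p : H.vertexPairs, Sym2.lift ⟨H.edist, H.edist_comm⟩ p.1

/-- A Šoltés hypergraph: a finite connected hypergraph such that the removal of any of its
vertices does not change its total distance. -/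
def IsSoltes (H : Hypergraph α) : Prop :=
  V(H).Finite ∧ H.Connected ∧ ∀ v ∈ V(H), (H.deleteVertex v).wienerIndex = H.wienerIndex

end Hypergraph

/-! ### Distances as natural numbers and the total distance as a sum over ordered pairs. -/

namespace Hypergraph

variable {α : Type*} {H : Hypergraph α}

/-! Let `w` be the common total distance. Fix distinct `s`, `t` at distance `d` and sum their
distance over the seven deletions of another vertex. A deletion matters only if it destroys a fixed
shortest path. For `d = 1` this path is one hyperedge, with one further vertex; for `d = 2` it is
two hyperedges, with at most three. If distances are cut off at 3, the sum is at most `8 * d + 1` in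
every case. Adding over the 72 ordered pairs and comparing with `9 * (2 * w)` gives `2 * w ≤ 72 +
X`, where `X` is the total amount by which distances in the deletions exceed 3
(`two_mul_le_sum_excess`). Moreover `X > 0`: otherwise all distances in the hypergraph are 1, and
then some pair makes the estimate strict.

It remains to see that one deletion contributes at most 2 to `X`, and that `w ≥ 47` if it
contributes at all (`excess_le_two`). Then `94 ≤ 2 * w ≤ 72 + 9 * 2 = 90`, a contradiction.

For this bound, list the eight vertices of the deletion by their distance from a vertex `x` whose
row of distances has the largest excess. Hyperedges of the deletion stay within two consecutive
distance layers, so the layer sequence, coded by six bits, limits the possible hyperedges. A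
contribution above 2 is refuted by finite case trees on which triples are hyperedges
(`check_refutation`). At each leaf, searches in the hypergraph of known hyperedges bound distances
from above, and searches in that of possible hyperedges bound them from below
(`Refutation.not_check`). -/

theorem HasWalk.edist_le {n : ℕ} {u v : α} (h : H.HasWalk n u v) : H.edist u v ≤ n :=
  iInf₂_le (f := fun (m : ℕ) (_ : H.HasWalk m u v) => (m : ℕ∞)) n h

theorem exists_hasWalk_of_edist_ne_top {u v : α} (h : H.edist u v ≠ ⊤) :
    ∃ n : ℕ, H.edist u v = n ∧ H.HasWalk n u v := by
  classical
  have hex : ∃ n, H.HasWalk n u v := by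
    by_contra! hne
    exact h (by simp [edist, hne])
  refine ⟨Nat.find hex, le_antisymm (Nat.find_spec hex).edist_le ?_, Nat.find_spec hex⟩
  exact le_iInf₂ fun n hn => Nat.cast_le.2 (Nat.find_min' hex hn)

theorem edist_self_of_mem {u : α} (hu : u ∈ V(H)) : H.edist u u = 0 :=
  le_antisymm (by simpa using (HasWalk.nil hu).edist_le) zero_le

/-- Twice the Wiener index is the sum of the distances over all ordered pairs of vertices. -/
theorem two_mul_wienerIndex (s : Finset α) (hs : (s : Set α) = V(H)) :
    2 * H.wienerIndex = ∑ a ∈ s, ∑ b ∈ s, H.edist a b := by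
  classical
  -- An arbitrary order selects one of the two orientations of each unordered pair.
  let _ : LinearOrder α := linearOrderOfSTO WellOrderingRel
  set f : Sym2 α → ℕ∞ := Sym2.lift ⟨H.edist, H.edist_comm⟩ with hf
  have hp : H.vertexPairs = ((s.sym2.filter fun p => ¬ p.IsDiag : Finset (Sym2 α)) : Set _) := by
    ext p
    simp only [vertexPairs, Set.mem_ofPred_eq, Finset.coe_filter, Finset.mem_sym2_iff, ← hs,
      Finset.mem_coe]
    tauto
  have hW : H.wienerIndex = ∑ i ∈ s.offDiag with i.1 < i.2, H.edist i.1 i.2 := by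
    have h1 : H.wienerIndex = ∑' p : H.vertexPairs, f p.1 := rfl
    rw [h1, hp, Finset.tsum_subtype' _ f, Finset.sum_sym2_filter_not_isDiag]
    simp [hf]
  have hgt : ∑ i ∈ s.offDiag with ¬ i.1 < i.2, H.edist i.1 i.2 = H.wienerIndex := by
    rw [hW]
    refine Finset.sum_nbij' Prod.swap Prod.swap ?_ ?_ (by simp) (by simp) ?_
    · rintro ⟨a, b⟩ h
      simp only [Finset.mem_filter, Finset.mem_offDiag, Prod.swap] at h ⊢
      exact ⟨⟨h.1.2.1, h.1.1, h.1.2.2.symm⟩, lt_of_le_of_ne (not_lt.1 h.2) h.1.2.2.symm⟩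
    · rintro ⟨a, b⟩ h
      simp only [Finset.mem_filter, Finset.mem_offDiag, Prod.swap] at h ⊢
      exact ⟨⟨h.1.2.1, h.1.1, h.1.2.2.symm⟩, not_lt.2 h.2.le⟩
    · rintro ⟨a, b⟩ _
      exact H.edist_comm a b
  have hoff : ∑ i ∈ s.offDiag, H.edist i.1 i.2 = 2 * H.wienerIndex := by
    rw [← Finset.sum_filter_add_sum_filter_not _ (fun i : α × α => i.1 < i.2), hgt, ← hW, two_mul]
  have hdiag : ∑ i ∈ s.diag, H.edist i.1 i.2 = 0 := by
    refine Finset.sum_eq_zero fun i hi => ?_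
    obtain ⟨hi, he⟩ := Finset.mem_diag.1 hi
    rw [← he]
    exact edist_self_of_mem (hs ▸ Finset.mem_coe.2 hi)
  rw [← Finset.sum_product', ← Finset.diag_union_offDiag,
    Finset.sum_union (Finset.disjoint_diag_offDiag s), hdiag, hoff, zero_add]

/-- The distance between two vertices as a natural number; it is meaningful for pairs of vertices
that are joined by a walk. -/
noncomputable def dist (H : Hypergraph α) (u v : α) : ℕ := (H.edist u v).toNat

theorem dist_comm (u v : α) : H.dist u v = H.dist v u := by rw [dist, edist_comm, dist]

theorem HasWalk.dist_le {n : ℕ} {u v : α} (h : H.HasWalk n u v) : H.dist u v ≤ n :=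
  ENat.toNat_le_of_le_natCast h.edist_le

theorem HasWalk.hasWalk_dist {n : ℕ} {u v : α} (h : H.HasWalk n u v) :
    H.HasWalk (H.dist u v) u v := by
  obtain ⟨m, hm, hw⟩ := exists_hasWalk_of_edist_ne_top
    (ne_top_of_le_ne_top (ENat.natCast_ne_top n) h.edist_le)
  rwa [dist, hm, ENat.toNat_natCast]

theorem dist_self {u : α} (hu : u ∈ V(H)) : H.dist u u = 0 := by
  simp [dist, edist_self_of_mem hu]

/-- Any two vertices are joined by a walk. -/
def Reachable (H : Hypergraph α) : Prop := ∀ u ∈ V(H), ∀ v ∈ V(H), ∃ n, H.HasWalk n u v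

/-- Reachability is essential: `dist` is also 0 for pairs joined by no walk, since `toNat` sends `⊤`
to 0. -/
theorem Reachable.eq_of_dist_eq_zero (hH : H.Reachable) {u v : α} (hu : u ∈ V(H)) (hv : v ∈ V(H))
    (h : H.dist u v = 0) : u = v := by
  obtain ⟨n, hn⟩ := hH u hu v hv
  have := hn.hasWalk_dist
  rw [h] at this
  cases this
  rfl

theorem Reachable.dist_le_succ (hH : H.Reachable) {e : Set α} (he : e ∈ E(H)) {u v w : α}
    (hu : u ∈ e) (hv : v ∈ e) (hw : w ∈ V(H)) : H.dist u w ≤ H.dist v w + 1 := by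
  obtain ⟨n, hn⟩ := hH v (mem_vertexSet_of_mem_edgeSet he hv) w hw
  exact (HasWalk.cons he hu hv hn.hasWalk_dist).dist_le

theorem dist_le_one {e : Set α} (he : e ∈ E(H)) {u v : α}
    (hu : u ∈ e) (hv : v ∈ e) : H.dist u v ≤ 1 :=
  (HasWalk.cons he hu hv (.nil (mem_vertexSet_of_mem_edgeSet he hv))).dist_le

theorem dist_le_two {e f : Set α} (he : e ∈ E(H)) (hf : f ∈ E(H)) {u v w : α}
    (hu : u ∈ e) (hv : v ∈ e) (hv' : v ∈ f) (hw : w ∈ f) : H.dist u w ≤ 2 :=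
  (HasWalk.cons he hu hv
    (.cons hf hv' hw (.nil (mem_vertexSet_of_mem_edgeSet hf hw)))).dist_le

theorem Reachable.exists_of_dist_eq_succ (hH : H.Reachable) {u w : α} (hu : u ∈ V(H))
    (hw : w ∈ V(H)) {n : ℕ} (h : H.dist u w = n + 1) :
    ∃ e ∈ E(H), u ∈ e ∧ ∃ v ∈ e, H.dist v w = n := by
  obtain ⟨m, hm⟩ := hH u hu w hw
  have hd := hm.hasWalk_dist
  rw [h] at hd
  cases hd with
  | @cons _ _ v _ e he hu hv hn =>
    refine ⟨e, he, hu, v, hv, le_antisymm hn.dist_le ?_⟩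
    have := hH.dist_le_succ he hu hv hw
    omega

theorem wienerIndex_ne_top (hV : V(H).Finite) (hH : H.Reachable) : H.wienerIndex ≠ ⊤ := by
  intro h
  have h2 := two_mul_wienerIndex (H := H) hV.toFinset (by simp)
  rw [h, ENat.mul_top (by norm_num), eq_comm, ENat.sum_eq_top] at h2
  obtain ⟨a, ha, h2⟩ := h2
  obtain ⟨b, hb, h2⟩ := ENat.sum_eq_top.1 h2
  obtain ⟨n, hn⟩ := hH a (by simpa using ha) b (by simpa using hb)
  exact absurd (top_le_iff.1 (h2 ▸ hn.edist_le)) (ENat.natCast_ne_top n)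

theorem reachable_of_wienerIndex_ne_top (hV : V(H).Finite) (hW : H.wienerIndex ≠ ⊤) :
    H.Reachable := by
  intro a ha b hb
  have h2 := two_mul_wienerIndex (H := H) hV.toFinset (by simp)
  have h3 : ∑ a ∈ hV.toFinset, ∑ b ∈ hV.toFinset, H.edist a b ≠ ⊤ :=
    h2 ▸ WithTop.mul_ne_top (ENat.natCast_ne_top 2) hW
  obtain ⟨n, -, hn⟩ := exists_hasWalk_of_edist_ne_top (H := H) (u := a) (v := b) fun h =>
    h3 (ENat.sum_eq_top.2 ⟨a, by simpa using ha, ENat.sum_eq_top.2 ⟨b, by simpa using hb, h⟩⟩)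
  exact ⟨n, hn⟩

theorem Reachable.sum_dist (hH : H.Reachable) (s : Finset α) (hs : (s : Set α) = V(H)) {w : ℕ}
    (hw : H.wienerIndex = w) : ∑ a ∈ s, ∑ b ∈ s, H.dist a b = 2 * w := by
  have h2 := two_mul_wienerIndex s hs
  have h3 : ∑ a ∈ s, ∑ b ∈ s, H.edist a b = ((∑ a ∈ s, ∑ b ∈ s, H.dist a b : ℕ) : ℕ∞) := by
    push_cast
    refine Finset.sum_congr rfl fun a ha => Finset.sum_congr rfl fun b hb => ?_
    obtain ⟨n, hn⟩ := hH a (hs ▸ Finset.mem_coe.2 ha) b (hs ▸ Finset.mem_coe.2 hb)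
    exact (ENat.natCast_toNat (ne_top_of_le_ne_top (ENat.natCast_ne_top n) hn.edist_le)).symm
  rw [h3, hw] at h2
  exact_mod_cast h2.symm

@[simp]
theorem vertexSet_deleteVertex (H : Hypergraph α) (v : α) : V(H.deleteVertex v) = V(H) \ {v} := rfl

theorem mem_edgeSet_deleteVertex {v : α} {e : Set α} :
    e ∈ E(H.deleteVertex v) ↔ e ∈ E(H) ∧ v ∉ e := Iff.rfl

end Hypergraph

/-! ### The averaging inequality over all vertex deletions. -/

namespace Hypergraph

variable {α : Type*} {H : Hypergraph α}

theorem IsUniform.exists_third (hH : H.IsUniform 3) {e : Set α} (he : e ∈ E(H)) {s t : α}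
    (hs : s ∈ e) (ht : t ∈ e) (hst : s ≠ t) : ∃ p, p ≠ s ∧ p ≠ t ∧ e = {s, t, p} := by
  obtain ⟨x, y, z, hxy, hxz, hyz, rfl⟩ := Set.encard_eq_three.1 (hH e he)
  simp only [Set.mem_insert_iff, Set.mem_singleton_iff] at hs ht
  rcases hs with rfl | rfl | rfl <;> rcases ht with rfl | rfl | rfl <;>
    first
    | exact absurd rfl hst
    | exact ⟨z, by grind, by grind, by grind⟩
    | exact ⟨y, by grind, by grind, by grind⟩
    | exact ⟨x, by grind, by grind, by grind⟩

/-- Used with `f v` the distance of a fixed pair after deletion of `v`, and `B` the set of vertices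
whose deletion may destroy a chosen shortest path of length `m`. Each of these costs at most `c - m`
more, apart from the part `g` above the cutoff `c`. -/
theorem sum_le_of_exceptional {A B : Finset α} {f g : α → ℕ} {m c : ℕ} (hmc : m ≤ c)
    (h1 : ∀ v ∈ A, v ∉ B → f v ≤ m) (h2 : ∀ v ∈ A, f v ≤ c + g v) :
    ∑ v ∈ A, f v ≤ A.card * m + B.card * (c - m) + ∑ v ∈ A, g v := by
  classical
  calc ∑ v ∈ A, f v ≤ ∑ v ∈ A, (m + (if v ∈ B then c - m else 0) + g v) := by
        refine Finset.sum_le_sum fun v hv => ?_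
        have := h2 v hv
        split_ifs with hB
        · omega
        · have := h1 v hv hB
          omega
    _ = A.card * m + (A ∩ B).card * (c - m) + ∑ v ∈ A, g v := by
        simp [Finset.sum_add_distrib]
    _ ≤ _ := by
        gcongr
        exact Finset.inter_subset_right

variable {V : Finset α}

open Classical in
/-- The total amount by which the distances in `H ∖ v` between vertices of `V` exceed `3`. -/
noncomputable def excess (H : Hypergraph α) (V : Finset α) (v : α) : ℕ :=
  ∑ s ∈ V.erase v, ∑ t ∈ V.erase v, ((H.deleteVertex v).dist s t - 3)

theorem Reachable.exists_edge_of_dist_eq_one (hr : H.Reachable) {s t : α} (hs : s ∈ V(H))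
    (ht : t ∈ V(H)) (h : H.dist s t = 1) : ∃ e ∈ E(H), s ∈ e ∧ t ∈ e := by
  obtain ⟨e, he, hse, x, hx, hxt⟩ := hr.exists_of_dist_eq_succ hs ht h
  have := hr.eq_of_dist_eq_zero (mem_vertexSet_of_mem_edgeSet he hx) ht hxt
  exact ⟨e, he, hse, this ▸ hx⟩

section

variable [DecidableEq α]

/-- Apart from the excess, the seven terms are at most `8 * d + 1`, where `d` is the original
distance. The summand `H.dist s t` on the left turns 8 into 9, to match the nine deletions when
summing over all pairs. -/
theorem sum_dist_deleteVertex_le (hu : H.IsUniform 3) (hV : (V : Set α) = V(H)) (hc : V.card = 9)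
    (hr : H.Reachable) {s t : α} (hs : s ∈ V) (ht : t ∈ V) (hst : s ≠ t) :
    ∑ v ∈ (V.erase s).erase t, (H.deleteVertex v).dist s t + H.dist s t ≤
      9 * H.dist s t + ∑ v ∈ (V.erase s).erase t, ((H.deleteVertex v).dist s t - 3) + 1 := by
  have hs' : s ∈ V(H) := hV ▸ Finset.mem_coe.2 hs
  have ht' : t ∈ V(H) := hV ▸ Finset.mem_coe.2 ht
  set A := (V.erase s).erase t with hA
  have hcA : A.card = 7 := by
    rw [hA, Finset.card_erase_of_mem (Finset.mem_erase.2 ⟨hst.symm, ht⟩),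
      Finset.card_erase_of_mem hs, hc]
  have h3 : ∀ v ∈ A, (H.deleteVertex v).dist s t ≤ 3 + ((H.deleteVertex v).dist s t - 3) :=
    fun v _ => by omega
  have hmem : ∀ v ∈ A, v ≠ s ∧ v ≠ t := fun v hv =>
    ⟨(Finset.mem_erase.1 (Finset.mem_erase.1 hv).2).1, (Finset.mem_erase.1 hv).1⟩
  rcases Nat.lt_or_ge 2 (H.dist s t) with hd | hd
  -- For distance at least 3 the cutoff suffices: 7 · 3 ≤ 8 · 3.
  · have := Finset.sum_le_sum h3
    rw [Finset.sum_add_distrib, Finset.sum_const, hcA, smul_eq_mul] at this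
    omega
  interval_cases hd' : H.dist s t
  · exact absurd (hr.eq_of_dist_eq_zero hs' ht' hd') hst
  · obtain ⟨e, he, hse, hte⟩ := hr.exists_edge_of_dist_eq_one hs' ht' hd'
    obtain ⟨p, -, -, rfl⟩ := hu.exists_third he hse hte hst
    -- Only deletion of `p` destroys the hyperedge: 7 · 1 + (3 - 1) = 9 = 8 · 1 + 1.
    have := sum_le_of_exceptional (B := {p}) (m := 1) (by norm_num) (fun v hv hp =>
      dist_le_one (H := H.deleteVertex v) ⟨he, by grind⟩ hse hte) h3
    rw [hcA, Finset.card_singleton] at this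
    omega
  · obtain ⟨e, he, hse, x, hxe, hxt⟩ := hr.exists_of_dist_eq_succ hs' ht' hd'
    have hx := mem_vertexSet_of_mem_edgeSet he hxe
    obtain ⟨f, hf, hxf, htf⟩ := hr.exists_edge_of_dist_eq_one hx ht' hxt
    have hsx : s ≠ x := by rintro rfl; omega
    have hxt' : x ≠ t := by rintro rfl; rw [dist_self hx] at hxt; omega
    obtain ⟨p, -, -, rfl⟩ := hu.exists_third he hse hxe hsx
    obtain ⟨q, -, -, rfl⟩ := hu.exists_third hf hxf htf hxt'
    -- At most three deletions destroy the path, each costing 3 - 2: 7 · 2 + 3 = 17 = 8 · 2 + 1.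
    have := sum_le_of_exceptional (B := {x, p, q}) (m := 2) (by norm_num) (fun v hv hp => by
      have := hmem v hv
      refine dist_le_two (H := H.deleteVertex v) ⟨he, ?_⟩ ⟨hf, ?_⟩ hse hxe hxf htf <;> grind) h3
    rw [hcA] at this
    have : Finset.card {x, p, q} ≤ 3 := Finset.card_le_three
    omega

/-- This improves the bound 9 for adjacent pairs by one. A pair in two hyperedges stays adjacent
under every deletion. Otherwise take a hyperedge `{s, t, p}` and a vertex `z` outside it: the
hyperedges through `s, z` and `z, t` avoid `p`, so deleting `p` leaves `s` and `t` at distance at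
most 2, and the sum is at most 6 + 2. -/
theorem exists_sum_dist_deleteVertex_le_eight (hu : H.IsUniform 3) (hV : (V : Set α) = V(H))
    (hc : V.card = 9) (hr : H.Reachable) (h1 : ∀ s ∈ V, ∀ t ∈ V, s ≠ t → H.dist s t = 1) :
    ∃ s ∈ V, ∃ t ∈ V, s ≠ t ∧
      ∑ v ∈ (V.erase s).erase t, (H.deleteVertex v).dist s t ≤ 8 := by
  have hV' : ∀ s ∈ V, s ∈ V(H) := fun s hs => hV ▸ Finset.mem_coe.2 hs
  have hadj : ∀ s ∈ V, ∀ t ∈ V, s ≠ t → ∃ e ∈ E(H), s ∈ e ∧ t ∈ e := fun s hs t ht hst =>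
    hr.exists_edge_of_dist_eq_one (hV' s hs) (hV' t ht) (h1 s hs t ht hst)
  have hcA : ∀ s ∈ V, ∀ t ∈ V, s ≠ t → ((V.erase s).erase t).card = 7 := fun s hs t ht hst => by
    rw [Finset.card_erase_of_mem (Finset.mem_erase.2 ⟨hst.symm, ht⟩),
      Finset.card_erase_of_mem hs, hc]
  have htwice : ∀ s ∈ V, ∀ t ∈ V, s ≠ t → ∀ e ∈ E(H), ∀ f ∈ E(H), s ∈ e → t ∈ e → s ∈ f → t ∈ f →
      e ≠ f → ∑ v ∈ (V.erase s).erase t, (H.deleteVertex v).dist s t ≤ 8 := by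
    intro s hs t ht hst e he f hf hse hte hsf htf hef
    obtain ⟨p, -, -, rfl⟩ := hu.exists_third he hse hte hst
    obtain ⟨q, -, -, rfl⟩ := hu.exists_third hf hsf htf hst
    have : ∀ v ∈ (V.erase s).erase t, (H.deleteVertex v).dist s t ≤ 1 := by
      intro v hv
      have hpq : p ≠ q := by rintro rfl; exact hef rfl
      by_cases hvp : v = p
      · exact dist_le_one (H := H.deleteVertex v) ⟨hf, by grind⟩ hsf htf
      · exact dist_le_one (H := H.deleteVertex v) ⟨he, by grind⟩ hse hte
    have := Finset.sum_le_card_nsmul _ _ _ this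
    rw [hcA s hs t ht hst] at this
    exact this.trans (by norm_num)
  obtain ⟨s, hs, t, ht, hst⟩ := Finset.one_lt_card.1 (by omega : 1 < V.card)
  obtain ⟨e, he, hse, hte⟩ := hadj s hs t ht hst
  obtain ⟨p, hps, hpt, rfl⟩ := hu.exists_third he hse hte hst
  have hp : p ∈ V := Finset.mem_coe.1 (hV ▸ mem_vertexSet_of_mem_edgeSet he (by simp))
  obtain ⟨z, hz, hz'⟩ := Finset.exists_mem_notMem_of_card_lt_card
    (s := {s, t, p}) (t := V) (by have : Finset.card {s, t, p} ≤ 3 := Finset.card_le_three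
                                  omega)
  simp only [Finset.mem_insert, Finset.mem_singleton, not_or] at hz'
  obtain ⟨f, hf, hsf, hzf⟩ := hadj s hs z hz (Ne.symm hz'.1)
  obtain ⟨g, hg, hzg, htg⟩ := hadj z hz t ht hz'.2.1
  by_cases hpf : p ∈ f
  · exact ⟨s, hs, p, hp, hps.symm, htwice s hs p hp hps.symm _ he f hf hse (by simp) hsf hpf
      (by rintro rfl; grind)⟩
  by_cases hpg : p ∈ g
  · exact ⟨t, ht, p, hp, hpt.symm, htwice t ht p hp hpt.symm _ he g hg hte (by simp) htg hpg
      (by rintro rfl; grind)⟩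
  refine ⟨s, hs, t, ht, hst, ?_⟩
  have := sum_le_of_exceptional (A := (V.erase s).erase t) (B := {p}) (m := 1) (c := 2)
    (f := fun v => (H.deleteVertex v).dist s t) (g := fun _ => 0) (by norm_num)
    (fun v hv hvp => dist_le_one (H := H.deleteVertex v) ⟨he, by grind⟩ hse hte)
    (fun v hv => by
      by_cases hvp : v = p
      · exact dist_le_two (H := H.deleteVertex v) ⟨hf, hvp ▸ hpf⟩ ⟨hg, hvp ▸ hpg⟩ hsf hzf hzg htg
      · exact (dist_le_one (H := H.deleteVertex v) ⟨he, by grind⟩ hse hte).trans (by norm_num))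
  rw [hcA s hs t ht hst, Finset.card_singleton] at this
  simpa using this

theorem sum_erase_comm (V : Finset α) (F : α → α → α → ℕ) :
    ∑ v ∈ V, ∑ s ∈ V.erase v, ∑ t ∈ V.erase v, F v s t =
      ∑ s ∈ V, ∑ t ∈ V, ∑ v ∈ (V.erase s).erase t, F v s t := by
  rw [Finset.sum_comm' (t' := V) (s' := fun s => V.erase s) (by grind)]
  refine Finset.sum_congr rfl fun s hs => ?_
  exact Finset.sum_comm' (by grind)

end

/-- The averaging inequality: if all vertex-deleted subhypergraphs have the total distance `w`
of `H`, then `w` is bounded in terms of the distances above `3` in these subhypergraphs. -/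
theorem two_mul_le_sum_excess (hu : H.IsUniform 3) (hV : (V : Set α) = V(H)) (hc : V.card = 9)
    (hr : H.Reachable) (hrv : ∀ v ∈ V, (H.deleteVertex v).Reachable) {w : ℕ}
    (hw : H.wienerIndex = w) (hwv : ∀ v ∈ V, (H.deleteVertex v).wienerIndex = w) :
    2 * w ≤ 72 + ∑ v ∈ V, excess H V v ∧ 0 < ∑ v ∈ V, excess H V v := by
  classical
  have hsum := hr.sum_dist V hV hw
  have hsumv : ∑ v ∈ V, ∑ s ∈ V.erase v, ∑ t ∈ V.erase v, (H.deleteVertex v).dist s t =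
      9 * (2 * w) := by
    rw [Finset.sum_congr rfl fun v hv => (hrv v hv).sum_dist (V.erase v) (by simp [hV]) (hwv v hv),
      Finset.sum_const, hc, smul_eq_mul]
  have hex : ∑ v ∈ V, excess H V v =
      ∑ s ∈ V, ∑ t ∈ V, ∑ v ∈ (V.erase s).erase t, ((H.deleteVertex v).dist s t - 3) := by
    rw [← sum_erase_comm V fun v s t => (H.deleteVertex v).dist s t - 3]
    refine Finset.sum_congr rfl fun v _ => ?_
    rw [excess]
  have hone : ∑ s ∈ V, ∑ t ∈ V, (if s = t then 0 else 1) = 72 := by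
    have : ∀ s ∈ V, ∑ t ∈ V, (if s = t then 0 else 1) = 8 := fun s hs => by
      have h := Finset.sum_filter (s := V) (fun t => s ≠ t) (fun _ => 1)
      simp only [ne_eq, ite_not] at h
      rw [← h, Finset.sum_const, smul_eq_mul, mul_one, Finset.filter_ne,
        Finset.card_erase_of_mem hs, hc]
    rw [Finset.sum_congr rfl this, Finset.sum_const, hc, smul_eq_mul]
  rw [sum_erase_comm] at hsumv
  have hpt : ∀ s ∈ V, ∀ t ∈ V,
      ∑ v ∈ (V.erase s).erase t, (H.deleteVertex v).dist s t + H.dist s t ≤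
      9 * H.dist s t + ∑ v ∈ (V.erase s).erase t, ((H.deleteVertex v).dist s t - 3) +
        (if s = t then 0 else 1) := by
    intro s hs t ht
    split_ifs with hst
    · subst hst
      have : ∑ v ∈ (V.erase s).erase s, (H.deleteVertex v).dist s s = 0 :=
        Finset.sum_eq_zero fun v hv => dist_self ⟨hV ▸ Finset.mem_coe.2 hs, by
          rintro rfl; simp at hv⟩
      omega
    · exact sum_dist_deleteVertex_le hu hV hc hr hs ht hst
  have hle := Finset.sum_le_sum fun s hs => Finset.sum_le_sum fun t ht => hpt s hs t ht
  simp only [Finset.sum_add_distrib, ← Finset.mul_sum] at hle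
  rw [hsum, hsumv, ← hex, hone] at hle
  -- Without excess, `2 * w ≤ 72`; as the 72 ordered pairs have distance at least 1, all these
  -- distances equal 1.
  refine ⟨by omega, Nat.pos_of_ne_zero fun h0 => ?_⟩
  have hge : ∀ s ∈ V, ∀ t ∈ V, (if s = t then 0 else 1) ≤ H.dist s t := by
    intro s hs t ht
    split_ifs with hst
    · exact Nat.zero_le _
    · exact Nat.one_le_iff_ne_zero.2 fun h => hst
        (hr.eq_of_dist_eq_zero (hV ▸ Finset.mem_coe.2 hs) (hV ▸ Finset.mem_coe.2 ht) h)
  have hge' := Finset.sum_le_sum fun s hs => Finset.sum_le_sum fun t ht => hge s hs t ht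
  rw [hone, hsum] at hge'
  have heq : ∑ s ∈ V, ∑ t ∈ V, (if s = t then 0 else 1) = ∑ s ∈ V, ∑ t ∈ V, H.dist s t := by
    rw [hone, hsum]; omega
  have h1 : ∀ s ∈ V, ∀ t ∈ V, s ≠ t → H.dist s t = 1 := by
    intro s hs t ht hst
    have := (Finset.sum_eq_sum_iff_of_le fun s hs => Finset.sum_le_sum fun t ht =>
      hge s hs t ht).1 heq s hs
    have := (Finset.sum_eq_sum_iff_of_le fun t ht => hge s hs t ht).1 this t ht
    rw [← this, if_neg hst]
  obtain ⟨s, hs, t, ht, hst, h8⟩ := exists_sum_dist_deleteVertex_le_eight hu hV hc hr h1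
  have hlt : ∑ s ∈ V, ∑ t ∈ V,
      (∑ v ∈ (V.erase s).erase t, (H.deleteVertex v).dist s t + H.dist s t) <
      ∑ s ∈ V, ∑ t ∈ V, (9 * H.dist s t +
        ∑ v ∈ (V.erase s).erase t, ((H.deleteVertex v).dist s t - 3) +
        (if s = t then 0 else 1)) := by
    refine Finset.sum_lt_sum (fun s hs => Finset.sum_le_sum fun t ht => hpt s hs t ht)
      ⟨s, hs, Finset.sum_lt_sum (fun t ht => hpt s hs t ht) ⟨t, ht, ?_⟩⟩
    rw [if_neg hst, h1 s hs t ht hst]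
    omega
  simp only [Finset.sum_add_distrib, ← Finset.mul_sum] at hlt
  rw [hsum, hsumv, ← hex, hone] at hlt
  omega

end Hypergraph

namespace MaskHypergraph

/-! ### Breadth-first search on hypergraphs whose hyperedges are given by bit masks -/

/-- Whether `t` belongs to the vertex set `R`. -/
def mem (t R : ℕ) : Bool := Nat.beq (Nat.land (Nat.shiftRight R t) 1) 1

/-- Adds to the vertex set `R` all hyperedges from the list `es` that meet it. -/
def expand (es : List ℕ) (R : ℕ) : ℕ :=
  es.foldr (fun e A => bif Nat.beq (Nat.land R e) 0 then A else Nat.lor A e) R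

/-- The number of vertices from the list `l` outside the vertex set `R`. -/
def missing : List ℕ → ℕ → ℕ
  | [], _ => 0
  | t :: l, R => bif mem t R then missing l R else Nat.succ (missing l R)

/-- The numbers of vertices missed in the first `k` rounds of the search from `R`, added up. -/
def missingSum (l es : List ℕ) : ℕ → ℕ → ℕ
  | 0, _ => 0
  | k + 1, R => missing l R + missingSum l es k (expand es R)

/-- The sum of `min d (j + k) - j`, for the distances `d` from `s` to the vertices in `l`. -/
def rowSum (l es : List ℕ) (j k s : ℕ) : ℕ :=
  missingSum l es k ((expand es)^[j] (2 ^ s))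

/-- The sum of `min d (j + k) - j`, for the distances `d` between the vertices in `l`. -/
def totalSum (l es : List ℕ) (j k : ℕ) : ℕ :=
  (l.map (rowSum l es j k)).sum

/-- All distances between vertices in `l` are at most `k`. -/
def diamLE (l es : List ℕ) (k : ℕ) : Bool :=
  l.all fun s => Nat.beq (missing l ((expand es)^[k] (2 ^ s))) 0

/-- The search from some vertex stops after at most `k` rounds, without reaching all of `l`. -/
def disconnects (l es : List ℕ) (k : ℕ) : Bool :=
  l.any fun s => Nat.beq (expand es ((expand es)^[k] (2 ^ s))) ((expand es)^[k] (2 ^ s)) &&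
    !Nat.beq (missing l ((expand es)^[k] (2 ^ s))) 0

theorem mem_eq_testBit (t R : ℕ) : mem t R = R.testBit t := by
  rw [Bool.eq_iff_iff, mem, Nat.beq_eq, Nat.testBit_eq_decide_div_mod_eq, decide_eq_true_eq,
    ← Nat.shiftRight_eq_div_pow, ← Nat.and_one_is_mod]
  rfl

theorem missing_eq (l : List ℕ) (R : ℕ) :
    missing l R = (l.map fun t => bif R.testBit t then 0 else 1).sum := by
  induction l with
  | nil => rfl
  | cons t l ih =>
    rw [missing, mem_eq_testBit, ih, List.map_cons, List.sum_cons]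
    rcases R.testBit t with _ | _ <;> simp [add_comm]

/-- The fold tests each hyperedge against the original `R`, not the accumulator, so one call is
exactly one round of the search. -/
theorem testBit_expand {es : List ℕ} {R i : ℕ} :
    (expand es R).testBit i ↔
      R.testBit i ∨ ∃ e ∈ es, (∃ j, R.testBit j ∧ e.testBit j) ∧ e.testBit i := by
  rw [expand]
  induction es with
  | nil => simp
  | cons e es ih =>
    rw [List.foldr_cons]
    rcases hb : Nat.beq (Nat.land R e) 0 with _ | _
    · have hne : R &&& e ≠ 0 := Nat.ne_of_beq_eq_false hb
      obtain ⟨j, hj⟩ := Nat.exists_testBit_of_ne_zero hne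
      rw [Nat.testBit_and, Bool.and_eq_true] at hj
      have : (∃ j, R.testBit j ∧ e.testBit j) ↔ True := iff_true_intro ⟨j, hj⟩
      rw [cond_false, Nat.lor_eq, Nat.testBit_or, Bool.or_eq_true, ih]
      simp only [List.mem_cons, exists_eq_or_imp, this, true_and]
      rw [or_assoc, or_comm (b := e.testBit i = true)]
    · have h0 : R &&& e = 0 := Nat.eq_of_beq_eq_true hb
      have : ¬ ∃ j, R.testBit j ∧ e.testBit j := by
        rintro ⟨j, h1, h2⟩
        have : (R &&& e).testBit j := by rw [Nat.testBit_and, h1, h2]; rfl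
        simp [h0] at this
      rw [cond_true, ih]
      simp only [List.mem_cons, exists_eq_or_imp, this, false_and, false_or]

/-- The function `d` is the distance function of the hypergraph with the vertices in `l` and the
hyperedges satisfying `Q`, which is connected. -/
structure IsDistance (Q : ℕ → Prop) (l : List ℕ) (d : ℕ → ℕ → ℕ) : Prop where
  self : ∀ s ∈ l, d s s = 0
  eq_of_eq_zero : ∀ s ∈ l, ∀ t ∈ l, d s t = 0 → s = t
  le_succ : ∀ m, Q m → ∀ i j, m.testBit i → m.testBit j → ∀ t ∈ l, d i t ≤ d j t + 1
  exists_of_eq_succ : ∀ s ∈ l, ∀ t ∈ l, ∀ n, d s t = n + 1 →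
    ∃ m, Q m ∧ m.testBit s ∧ ∃ j ∈ l, m.testBit j ∧ d j t = n

namespace IsDistance

variable {Q : ℕ → Prop} {l es : List ℕ} {d : ℕ → ℕ → ℕ}

/-- If all of `es` are hyperedges, whatever the search reaches is near: known hyperedges give upper
bounds on distances. The start set is arbitrary because the induction peels off the first round. -/
theorem exists_le_of_testBit (hd : IsDistance Q l d) (hes : ∀ e ∈ es, Q e) {t : ℕ} (ht : t ∈ l)
    (k R : ℕ) (h : ((expand es)^[k] R).testBit t) : ∃ r, R.testBit r ∧ d r t ≤ k := by
  induction k generalizing R with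
  | zero => exact ⟨t, h, (hd.self t ht).le⟩
  | succ k ih =>
    obtain ⟨r, hr, hrt⟩ := ih _ h
    rcases testBit_expand.1 hr with hr | ⟨e, he, ⟨j, hj, hej⟩, her⟩
    · exact ⟨r, hr, hrt.trans k.le_succ⟩
    · exact ⟨j, hj, (hd.le_succ e (hes e he) j r hej her t ht).trans (Nat.succ_le_succ hrt)⟩

theorem le_of_testBit (hd : IsDistance Q l d) (hes : ∀ e ∈ es, Q e) {s t k : ℕ} (ht : t ∈ l)
    (h : ((expand es)^[k] (2 ^ s)).testBit t) : d s t ≤ k := by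
  obtain ⟨r, hr, hrt⟩ := hd.exists_le_of_testBit hes ht k _ h
  rw [Nat.testBit_two_pow, decide_eq_true_eq] at hr
  rwa [hr]

/-- The converse direction, for `es` containing all hyperedges: following a shortest path, the
search reaches everything near, so a vertex not reached is far. -/
theorem testBit_of_le (hd : IsDistance Q l d) (hes : ∀ e, Q e → e ∈ es) {t : ℕ} (ht : t ∈ l)
    (k R s : ℕ) (hs : s ∈ l) (hR : R.testBit s) (h : d s t ≤ k) :
    ((expand es)^[k] R).testBit t := by
  induction k generalizing R s with
  | zero => rwa [← hd.eq_of_eq_zero s hs t ht (Nat.le_zero.1 h)]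
  | succ k ih =>
    rcases Nat.lt_or_ge k (d s t) with hk | hk
    · obtain ⟨m, hm, hms, j, hj, hmj, hjt⟩ :=
        hd.exists_of_eq_succ s hs t ht k (le_antisymm h hk)
      exact ih _ j hj (testBit_expand.2 (.inr ⟨m, hes m hm, ⟨s, hR, hms⟩, hmj⟩)) hjt.le
    · exact ih _ s hs (testBit_expand.2 (.inl hR)) hk

theorem lt_of_not_testBit (hd : IsDistance Q l d) (hes : ∀ e, Q e → e ∈ es) {s t k : ℕ}
    (hs : s ∈ l) (ht : t ∈ l) (h : ¬ ((expand es)^[k] (2 ^ s)).testBit t) : k < d s t :=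
  not_le.1 fun hle => h (hd.testBit_of_le hes ht k _ s hs (by simp) hle)

end IsDistance

/-- `D t - j` counts the `i` with `j + i < D t`, and each round `i` that misses `t` supplies such an
`i`. Stopping after `k` rounds only lowers the count. -/
theorem missingSum_le {es : List ℕ} {D : ℕ → ℕ} {k j R : ℕ} (l : List ℕ)
    (h : ∀ i < k, ∀ t ∈ l, ¬ ((expand es)^[i] R).testBit t → j + i < D t) :
    missingSum l es k R ≤ (l.map fun t => D t - j).sum := by
  induction k generalizing j R with
  | zero => simp [missingSum]
  | succ k ih =>
    rw [missingSum, missing_eq]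
    have h1 := ih (j := j + 1) (R := expand es R) fun i hi t ht hb => by
      have := h (i + 1) (by omega) t ht hb
      omega
    refine (Nat.add_le_add_left h1 _).trans ?_
    rw [← List.sum_map_add]
    refine List.sum_le_sum fun t ht => ?_
    have h0 := h 0 (by omega) t ht
    rcases hb : R.testBit t with _ | _
    · have := h0 (by simp [hb])
      simp only [cond_false]
      omega
    · simp only [cond_true]
      omega

/-- The same count from the other side. Here `hk` is needed, so that stopping after `k` rounds loses
nothing. -/
theorem le_missingSum {es : List ℕ} {D : ℕ → ℕ} {k j R : ℕ} (l : List ℕ)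
    (h : ∀ i < k, ∀ t ∈ l, ((expand es)^[i] R).testBit t → D t ≤ j + i)
    (hk : ∀ t ∈ l, D t ≤ j + k) :
    (l.map fun t => D t - j).sum ≤ missingSum l es k R := by
  induction k generalizing j R with
  | zero =>
    refine le_of_eq (List.sum_eq_zero fun x hx => ?_)
    obtain ⟨t, ht, rfl⟩ := List.mem_map.1 hx
    have := hk t ht
    omega
  | succ k ih =>
    rw [missingSum, missing_eq]
    have h1 := ih (j := j + 1) (R := expand es R) (fun i hi t ht hb => by
      have := h (i + 1) (by omega) t ht hb
      omega) (fun t ht => by have := hk t ht; omega)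
    refine le_trans ?_ (Nat.add_le_add_left h1 _)
    rw [← List.sum_map_add]
    refine List.sum_le_sum fun t ht => ?_
    have h0 := h 0 (by omega) t ht
    rcases hb : R.testBit t with _ | _
    · simp only [cond_false]
      omega
    · have := h0 hb
      simp only [cond_true]
      omega

theorem missing_eq_zero {l : List ℕ} {R : ℕ} : missing l R = 0 ↔ ∀ t ∈ l, R.testBit t := by
  rw [missing_eq, List.sum_eq_zero_iff]
  simp only [List.mem_map, forall_exists_index, and_imp, forall_apply_eq_imp_iff₂]
  refine forall₂_congr fun t _ => ?_
  rcases R.testBit t with _ | _ <;> simp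

namespace IsDistance

variable {Q : ℕ → Prop} {l es : List ℕ} {d : ℕ → ℕ → ℕ}

theorem rowSum_le (hd : IsDistance Q l d) (hes : ∀ e, Q e → e ∈ es) {s : ℕ} (hs : s ∈ l)
    (j k : ℕ) : rowSum l es j k s ≤ (l.map fun t => d s t - j).sum :=
  missingSum_le l fun i _ t ht h => hd.lt_of_not_testBit hes hs ht (by
    rwa [← Function.iterate_add_apply, add_comm] at h)

theorem totalSum_le (hd : IsDistance Q l d) (hes : ∀ e, Q e → e ∈ es) (j k : ℕ) :
    totalSum l es j k ≤ (l.map fun s => (l.map fun t => d s t - j).sum).sum :=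
  List.sum_le_sum fun _ hs => hd.rowSum_le hes hs j k

theorem le_of_diamLE (hd : IsDistance Q l d) (hes : ∀ e ∈ es, Q e) {k : ℕ}
    (hk : diamLE l es k) {s t : ℕ} (hs : s ∈ l) (ht : t ∈ l) : d s t ≤ k :=
  hd.le_of_testBit hes ht
    (missing_eq_zero.1 (Nat.eq_of_beq_eq_true (List.all_eq_true.1 hk s hs)) t ht)

theorem le_totalSum (hd : IsDistance Q l d) (hes : ∀ e ∈ es, Q e) {j k : ℕ}
    (hk : diamLE l es (j + k)) :
    (l.map fun s => (l.map fun t => d s t - j).sum).sum ≤ totalSum l es j k :=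
  List.sum_le_sum fun _ hs => le_missingSum l (fun i _ t ht h => hd.le_of_testBit hes ht (by
    rwa [← Function.iterate_add_apply, add_comm] at h)) fun _ ht => hd.le_of_diamLE hes hk hs ht

theorem not_disconnects (hd : IsDistance Q l d) (hes : ∀ e, Q e → e ∈ es) (k : ℕ) :
    disconnects l es k = false := by
  rw [← Bool.not_eq_true, disconnects, List.any_eq_true]
  rintro ⟨s, hs, h⟩
  rw [Bool.and_eq_true, Bool.not_eq_true'] at h
  set R := (expand es)^[k] (2 ^ s)
  have hR : R.testBit s :=
    hd.testBit_of_le hes hs k _ s hs (by simp) ((hd.self s hs).le.trans k.zero_le)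
  refine Nat.ne_of_beq_eq_false h.2 (missing_eq_zero.2 fun t ht => ?_)
  have := hd.testBit_of_le hes ht (d s t) R s hs hR le_rfl
  -- The search is stationary at `R`, so running it for `d s t` further rounds, enough to reach `t`,
  -- yields `R` again.
  rwa [Function.iterate_fixed (Nat.eq_of_beq_eq_true h.1)] at this

end IsDistance

end MaskHypergraph

namespace MaskHypergraph

/-! ### The hypergraphs of order nine

The vertices are the numbers below `9`; deleting the "vertex" `9` means deleting nothing. -/

/-- The vertices other than `u`. -/
def vertices (u : ℕ) : List ℕ := (List.range 9).filter fun t => !Nat.beq t u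

/-- The masks from `es` that do not contain the vertex `u`. -/
def avoid (u : ℕ) (es : List ℕ) : List ℕ := es.filter fun e => !mem u e

/-- The masks of the sets of three vertices. -/
def triples : List ℕ :=
  (List.range 9).flatMap fun a => (List.range a).flatMap fun b => (List.range b).map fun c =>
    2 ^ a ||| 2 ^ b ||| 2 ^ c

/-- The `i`-th term of the sequence that starts with `0, 1` and then increases by the binary
digits of `c`. -/
def layer (c : ℕ) : ℕ → ℕ
  | 0 => 0
  | 1 => 1
  | i + 2 => layer c (i + 1) + bif c.testBit i then 1 else 0

/-- The triples that contain the vertex `8` or else lie in two consecutive layers. -/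
def layered (c : ℕ) : List ℕ :=
  triples.filter fun e => mem 8 e || (List.range 8).all fun i => !mem i e ||
    (List.range 8).all fun j => !mem j e || Nat.ble (layer c i) (layer c j + 1)

/-- A refutation of the existence of a hypergraph containing certain hyperedges and contained in
another hypergraph, all of whose vertex deletions have the same total distance. -/
inductive Refutation : Type
  /-- Deletion of `u` disconnects even the larger hypergraph. -/
  | disc (u : ℕ)
  /-- Too many vertices are far from `s` after deletion of the vertex `8`. -/
  | wide (s : ℕ)
  /-- Too few pairs of vertices are far from each other after deletion of the vertex `8`. -/
  | few
  /-- Deletion of `u` and deletion of `u'` give different total distances. -/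
  | gap (u u' : ℕ)
  /-- Case distinction on whether `e` is a hyperedge. -/
  | split (e : ℕ) (l r : Refutation)

/-- Checks a refutation, given the hyperedges `es` of the smaller and `fs` of the larger
hypergraph. -/
def Refutation.check (ρ : ℕ) : List ℕ → List ℕ → Refutation → Bool
  | _, fs, disc u => Nat.ble u 9 && disconnects (vertices u) (avoid u fs) 5
  | _, fs, wide s => (vertices 8).elem s &&
      Nat.ble (ρ + 1) (rowSum (vertices 8) (avoid 8 fs) 3 2 s)
  | es, _, few => diamLE (vertices 8) (avoid 8 es) 5 &&
      Nat.ble (totalSum (vertices 8) (avoid 8 es) 3 2) 2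
  | es, fs, gap u u' => Nat.ble u 9 && Nat.ble u' 9 && diamLE (vertices u) (avoid u es) 5 &&
      Nat.ble (totalSum (vertices u) (avoid u es) 0 5 + 1)
        (totalSum (vertices u') (avoid u' fs) 0 4)
  | es, fs, split e l r => check ρ (e :: es) fs l && check ρ es (fs.filter fun f => !Nat.beq f e) r

variable {P : ℕ → Prop} {D : ℕ → ℕ → ℕ → ℕ} {W ρ : ℕ}

/-- Soundness of refutations: the true hyperedges `P` lie between `es` and `fs`, and each branching
on `e` enlarges `es` or shrinks `fs`. `hρ` encodes that vertex 0 has the largest row excess in the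
deletion of vertex 8, and `h3` is the assumption to be refuted. -/
theorem Refutation.not_check
    (hD : ∀ u ≤ 9, IsDistance (fun m => P m ∧ ¬ m.testBit u) (vertices u) (D u))
    (hW : ∀ u ≤ 9, ((vertices u).map fun s => ((vertices u).map fun t => D u s t).sum).sum = W)
    (hρ : ∀ s ∈ vertices 8, ((vertices 8).map fun t => D 8 s t - 3).sum ≤ ρ)
    (h3 : 3 ≤ ((vertices 8).map fun s => ((vertices 8).map fun t => D 8 s t - 3).sum).sum)
    (T : Refutation) {es fs : List ℕ} (hes : ∀ e ∈ es, P e) (hfs : ∀ e, P e → e ∈ fs) :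
    T.check ρ es fs = false := by
  have hes' : ∀ (u : ℕ) {es : List ℕ}, (∀ e ∈ es, P e) →
      ∀ e ∈ avoid u es, P e ∧ ¬ e.testBit u := fun u es hes e he => by
    have := List.mem_filter.1 he
    exact ⟨hes e this.1, by simpa [mem_eq_testBit] using this.2⟩
  have hfs' : ∀ (u : ℕ) {fs : List ℕ}, (∀ e, P e → e ∈ fs) →
      ∀ e, P e ∧ ¬ e.testBit u → e ∈ avoid u fs := fun u fs hfs e he =>
    List.mem_filter.2 ⟨hfs e he.1, by simpa [mem_eq_testBit] using he.2⟩
  induction T generalizing es fs with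
  | disc u =>
    rw [check, Bool.and_eq_false_imp]
    exact fun hu => (hD u (Nat.le_of_ble_eq_true hu)).not_disconnects (hfs' u hfs) 5
  | wide s =>
    rw [check, Bool.and_eq_false_imp]
    intro hs
    have hs := List.mem_of_elem_eq_true hs
    have := ((hD 8 (by norm_num)).rowSum_le (hfs' 8 hfs) hs 3 2).trans (hρ s hs)
    exact Bool.eq_false_iff.2 fun h => by
      have := Nat.le_of_ble_eq_true h
      omega
  | few =>
    rw [check, Bool.and_eq_false_imp]
    intro hk
    have := h3.trans ((hD 8 (by norm_num)).le_totalSum (hes' 8 hes) (j := 3) (k := 2) hk)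
    exact Bool.eq_false_iff.2 fun h => by
      have := Nat.le_of_ble_eq_true h
      omega
  | gap u u' =>
    rw [check, Bool.and_eq_false_imp]
    intro h
    simp only [Bool.and_eq_true] at h
    obtain ⟨⟨hu, hu'⟩, hk⟩ := h
    have hu := Nat.le_of_ble_eq_true hu
    have hu' := Nat.le_of_ble_eq_true hu'
    have h1 := (hD u hu).le_totalSum (hes' u hes) (j := 0) (k := 5) hk
    have h2 := (hD u' hu').totalSum_le (hfs' u' hfs) 0 4
    simp only [Nat.sub_zero] at h1 h2
    rw [hW u hu] at h1
    rw [hW u' hu'] at h2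
    exact Bool.eq_false_iff.2 fun h => by
      have := Nat.le_of_ble_eq_true h
      omega
  | split e l r ihl ihr =>
    rw [check, Bool.and_eq_false_imp]
    intro hl
    by_cases he : P e
    · rw [ihl (List.forall_mem_cons.2 ⟨he, hes⟩) hfs] at hl
      exact absurd hl (by simp)
    · refine ihr hes fun f hf => List.mem_filter.2 ⟨hfs f hf, ?_⟩
      rw [Bool.not_eq_true', ← Bool.not_eq_true]
      exact fun h => he (Nat.eq_of_beq_eq_true h ▸ hf)

/-- The sum of the amounts by which the terms of the layer sequence exceed `3`. -/
def layerExcess (c : ℕ) : ℕ := ((vertices 8).map fun i => layer c i - 3).sum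

/-- A refutation for every layer sequence. -/
def refutation : ℕ → Refutation
  -- The codes 22 and 26 have layer sizes 1, 2, 1, 2, 2 and 1, 2, 2, 1, 2. Two vertices are at
  -- distance 4 from vertex 0, so the excess is already too large, and the trees play the total
  -- distances of different deletions against each other.
  | 22 =>
    .split 7 (.split 56 (.split 14 (.split 322 (.gap 7 8) (.split 324 (.gap 7 8) (.split 328 (.gap
    7 8) (.split 386 (.gap 6 8) (.split 388 (.gap 6 8) (.split 392 (.gap 6 8) (.split 208 (.split
    266 (.gap 0 8) (.split 268 (.gap 0 8) (.split 274 (.gap 0 8) (.split 276 (.gap 0 8) (.split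
    280 (.gap 0 8) (.split 290 (.gap 0 8) (.split 259 (.split 273 (.gap 2 8) (.split 292 (.gap 0
    8) (.split 261 (.split 296 (.gap 0 8) (.split 304 (.gap 3 8) (.split 321 (.gap 5 8) (.split
    336 (.gap 7 8) (.split 352 (.gap 7 8) (.split 112 (.split 265 (.gap 7 8) (.split 289 (.gap 7
    8) (.split 448 (.gap 3 7) (.gap 7 9)))) (.disc 7))))))) (.disc 1)))) (.disc 2)))))))) (.split
    224 (.split 266 (.gap 0 8) (.split 268 (.gap 0 8) (.split 274 (.gap 0 8) (.split 276 (.gap 0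
    8) (.split 280 (.gap 0 8) (.split 290 (.gap 0 8) (.split 259 (.split 289 (.gap 2 8) (.split
    292 (.gap 0 8) (.split 261 (.split 296 (.gap 4 8) (.split 304 (.gap 3 8) (.split 321 (.gap 4
    8) (.split 336 (.gap 7 8) (.split 448 (.gap 4 8) (.disc 5)))))) (.disc 1)))) (.disc 2))))))))
    (.split 112 (.split 176 (.split 265 (.gap 6 8) (.split 266 (.gap 0 8) (.split 268 (.gap 0 8)
    (.split 273 (.gap 6 8) (.split 274 (.gap 0 8) (.split 276 (.gap 0 8) (.split 280 (.gap 0 8)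
    (.split 289 (.gap 6 8) (.split 290 (.gap 0 8) (.split 259 (.split 261 (.gap 6 8) (.split 292
    (.gap 6 8) (.disc 1))) (.disc 2))))))))))) (.disc 8)) (.disc 8)))))))))) (.disc 8)) (.disc 8))
    (.disc 8)
  | 26 =>
    .split 7 (.split 56 (.split 224 (.split 14 (.split 266 (.gap 0 8) (.split 268 (.gap 0 8)
    (.split 274 (.gap 0 8) (.split 276 (.gap 0 8) (.split 280 (.gap 0 8) (.split 290 (.gap 0 8)
    (.split 292 (.gap 0 8) (.split 296 (.gap 0 8) (.split 304 (.gap 0 8) (.split 322 (.gap 0 8)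
    (.split 324 (.gap 0 8) (.split 328 (.gap 0 8) (.split 336 (.gap 0 8) (.split 352 (.gap 0 8)
    (.split 321 (.split 265 (.gap 7 8) (.split 273 (.gap 7 8) (.split 289 (.gap 7 8) (.split 385
    (.gap 4 8) (.split 386 (.gap 4 8) (.split 388 (.gap 4 8) (.split 392 (.gap 4 8) (.split 400
    (.gap 0 8) (.split 416 (.gap 0 8) (.disc 6)))))))))) (.disc 7)))))))))))))))) (.split 26
    (.split 265 (.gap 2 8) (.split 268 (.gap 0 8) (.split 273 (.gap 2 8) (.split 276 (.gap 0 8)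
    (.split 289 (.gap 2 8) (.split 292 (.gap 0 8) (.split 322 (.gap 7 8) (.split 328 (.gap 7 8)
    (.split 336 (.gap 7 8) (.split 386 (.gap 6 8) (.split 392 (.gap 6 8) (.split 400 (.gap 6 8)
    (.split 28 (.split 266 (.gap 0 8) (.split 296 (.gap 0 8) (.disc 4))) (.split 22 (.split 266
    (.gap 0 8) (.split 296 (.gap 0 8) (.disc 4))) (.split 321 (.gap 2 8) (.split 324 (.gap 0 8)
    (.split 352 (.split 259 (.gap 2 8) (.split 385 (.gap 2 8) (.disc 2))) (.disc
    7)))))))))))))))))) (.split 22 (.split 266 (.gap 0 8) (.split 268 (.gap 0 8) (.split 274 (.gap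
    0 8) (.split 276 (.gap 0 8) (.split 280 (.gap 0 8) (.split 290 (.gap 0 8) (.split 292 (.gap 0
    8) (.split 296 (.gap 0 8) (.split 304 (.gap 0 8) (.split 322 (.gap 0 8) (.split 324 (.gap 0 8)
    (.split 328 (.gap 0 8) (.split 336 (.gap 0 8) (.split 352 (.gap 0 8) (.split 321 (.split 262
    (.gap 3 8) (.split 265 (.gap 7 8) (.split 392 (.gap 0 8) (.disc 4)))) (.disc 7))))))))))))))))
    (.split 28 (.split 265 (.gap 1 8) (.split 266 (.gap 0 8) (.split 273 (.gap 1 8) (.split 274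
    (.gap 0 8) (.split 289 (.gap 1 8) (.split 290 (.gap 0 8) (.split 321 (.gap 1 8) (.split 322
    (.gap 0 8) (.split 324 (.gap 7 8) (.split 328 (.gap 7 8) (.split 336 (.gap 7 8) (.split 352
    (.split 259 (.gap 7 8) (.split 385 (.gap 1 8) (.disc 2))) (.disc 7))))))))))))) (.disc 8)))))
    (.disc 8)) (.disc 8)) (.disc 8)
  -- The codes 38, 42 and 44 have layer sizes 1, 2, 1, 3, 1 and 1, 2, 2, 2, 1 and 1, 3, 1, 2, 1.
  -- Only one vertex is at distance 4 from vertex 0, and the deletion of vertex 8 alone gives the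
  -- contradiction: its excess is at most 2, or another vertex has a larger row excess, or it is
  -- disconnected.
  | 38 =>
    .split 7 (.split 14 (.split 56 (.split 208 (.split 88 .few (.split 104 .few (.wide 0)))
    (.split 224 (.split 88 .few (.split 104 .few (.wide 0))) (.split 176 (.split 88 .few (.split
    104 .few (.wide 0))) (.disc 8)))) (.split 88 (.split 104 (.split 176 .few (.split 208 .few
    (.split 224 .few (.disc 8)))) (.wide 0)) (.wide 0))) (.disc 8)) (.disc 8)
  | 42 =>
    .split 7 (.split 224 (.split 26 (.split 104 (.split 14 .few (.split 28 .few (.split 22 (.split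
    56 .few (.split 88 .few (.split 112 .few (.wide 7)))) (.wide 7)))) (.split 112 (.split 22 .few
    (.split 28 .few (.split 14 (.split 56 .few (.split 88 .few (.wide 7))) (.wide 7)))) (.split 56
    (.split 88 (.split 14 .few (.split 22 .few (.split 28 .few (.wide 7)))) (.wide 0)) (.wide
    0)))) (.split 28 (.split 104 (.split 14 .few (.split 22 (.split 56 .few (.split 88 .few
    (.split 112 .few (.wide 7)))) (.wide 7))) (.split 112 (.split 22 .few (.split 14 (.split 56
    .few (.split 88 .few (.wide 7))) (.wide 7))) (.split 56 (.split 88 (.split 14 .few (.split 22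
    .few (.wide 7))) (.wide 0)) (.wide 0)))) (.split 56 (.split 14 (.split 88 .few (.split 104
    .few (.split 22 (.split 112 .few (.wide 0)) (.wide 0)))) (.split 22 (.split 88 .few (.split
    112 .few (.wide 0))) (.disc 8))) (.split 88 (.split 14 (.split 104 .few (.split 22 (.split 112
    .few (.wide 0)) (.wide 0))) (.split 22 (.split 112 .few (.wide 0)) (.disc 8))) (.split 14
    (.split 104 (.split 22 (.split 112 .few (.wide 7)) (.wide 0)) (.wide 7)) (.wide 0)))))) (.disc
    8)) (.disc 8)
  | 44 =>
    .split 112 (.split 224 (.split 22 (.split 11 (.split 26 .few (.split 28 .few (.wide 7)))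
    (.split 13 (.split 26 .few (.split 28 .few (.wide 7))) (.split 7 (.split 26 .few (.split 28
    .few (.wide 7))) (.disc 8)))) (.split 26 (.split 28 (.split 7 .few (.split 11 .few (.split 13
    .few (.disc 8)))) (.wide 7)) (.wide 7))) (.disc 8)) (.disc 8)
  -- For every other code with a vertex at distance at least 4, some two consecutive layers have
  -- only two vertices in total, so no hyperedge of size 3 joins them.
  | _ => .disc 8

theorem check_refutation : ∀ c < 64, 4 ≤ layer c 7 →
    (refutation c).check (layerExcess c) [] (layered c) = true := by
  decide +kernel

/-- The source of `w ≥ 47`: even with all triples compatible with the layers, the sum over ordered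
pairs is at least 94 unless the deletion is disconnected. -/
theorem layered_disconnects_or_le : ∀ c < 64, 4 ≤ layer c 7 →
    disconnects (vertices 8) (avoid 8 (layered c)) 5 = true ∨
      94 ≤ totalSum (vertices 8) (avoid 8 (layered c)) 0 4 := by
  decide +kernel

end MaskHypergraph

/-! ### Masks of triples and the coding of layer sequences. -/

namespace MaskHypergraph

theorem mem_vertices {u t : ℕ} : t ∈ vertices u ↔ t < 9 ∧ t ≠ u := by
  rw [vertices, List.mem_filter, List.mem_range, Bool.not_eq_true', ← Bool.not_eq_true, Nat.beq_eq]

theorem nodup_vertices (u : ℕ) : (vertices u).Nodup := List.nodup_range.filter _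

theorem lt_nine_of_mem_triples {m : ℕ} (hm : m ∈ triples) {i : ℕ} (hi : m.testBit i) : i < 9 := by
  have h : ∀ m ∈ triples, m < 2 ^ 9 := by decide +kernel
  by_contra! h9
  rw [Nat.testBit_lt_two_pow ((h m hm).trans_le (Nat.pow_le_pow_right two_pos h9))] at hi
  exact absurd hi (by simp)

theorem mem_triples {a b c : ℕ} (ha : a < 9) (hb : b < 9) (hc : c < 9) (hab : a ≠ b)
    (hac : a ≠ c) (hbc : b ≠ c) : 2 ^ a ||| 2 ^ b ||| 2 ^ c ∈ triples := by
  have h : ∀ a b c : Fin 9, a ≠ b → a ≠ c → b ≠ c →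
      2 ^ a.1 ||| 2 ^ b.1 ||| 2 ^ c.1 ∈ triples := by decide +kernel
  exact h ⟨a, ha⟩ ⟨b, hb⟩ ⟨c, hc⟩ (by simpa using hab) (by simpa using hac) (by simpa using hbc)

theorem layer_le_layer (c : ℕ) {i j : ℕ} (h : i ≤ j) : layer c i ≤ layer c j := by
  refine monotone_nat_of_le_succ (fun n => ?_) h
  rcases n with _ | n
  · simp [layer]
  · rw [layer]
    exact Nat.le_add_right _ _

/-- Bit `i` of `c` records whether `F` increases from `i + 1` to `i + 2`. The first two values are
fixed, which leaves six bits for eight terms. -/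
theorem exists_eq_layer (F : ℕ → ℕ) (h0 : F 0 = 0) (h1 : F 1 = 1)
    (h : ∀ i < 7, F i ≤ F (i + 1) ∧ F (i + 1) ≤ F i + 1) :
    ∃ c < 64, ∀ i < 8, F i = layer c i := by
  refine ⟨Nat.ofBits fun i : Fin 6 => decide (F (i + 2) ≠ F (i + 1)), Nat.ofBits_lt_two_pow _,
    fun i hi => ?_⟩
  induction i using Nat.strong_induction_on with
  | _ i ih =>
    rcases i with _ | _ | i
    · rw [h0]; rfl
    · rw [h1]; rfl
    · rw [layer, ← ih (i + 1) (by omega) (by omega), Nat.testBit_ofBits_lt _ _ (by omega)]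
      have := h (i + 1) (by omega)
      by_cases he : F (i + 2) = F (i + 1)
      · simp [he]
      · simp only [ne_eq, he, not_false_eq_true, decide_true, cond_true]
        have : F (i + 1 + 1) = F (i + 2) := rfl
        omega

end MaskHypergraph

/-! ### Transfer from abstract hypergraphs to labelled ones. -/

namespace Hypergraph

open MaskHypergraph

variable {α : Type*} {H : Hypergraph α} {σ : ℕ → α} {l : List ℕ}

theorem sum_map_eq_sum {S : Finset α} (hl : l.Nodup) (hinj : ∀ s ∈ l, ∀ t ∈ l, σ s = σ t → s = t)
    (hS : ∀ a, a ∈ S ↔ ∃ s ∈ l, σ s = a) (f : α → ℕ) :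
    (l.map fun s => f (σ s)).sum = ∑ a ∈ S, f a := by
  classical
  have : S = l.toFinset.image σ := by
    ext a
    simp [hS]
  rw [this, Finset.sum_image fun s hs t ht => hinj s (by simpa using hs) t (by simpa using ht),
    List.sum_toFinset _ hl]

theorem Reachable.isDistance (hH : H.Reachable) (hl : ∀ a, a ∈ V(H) ↔ ∃ s ∈ l, σ s = a)
    (hinj : ∀ s ∈ l, ∀ t ∈ l, σ s = σ t → s = t) {Q : ℕ → Prop}
    (hQ : ∀ m, Q m → ∃ e ∈ E(H), ∀ i, m.testBit i → σ i ∈ e)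
    (hE : ∀ e ∈ E(H), ∃ m, Q m ∧ ∀ s ∈ l, σ s ∈ e → m.testBit s) :
    IsDistance Q l fun s t => H.dist (σ s) (σ t) where
  self s hs := dist_self ((hl _).2 ⟨s, hs, rfl⟩)
  eq_of_eq_zero s hs t ht h := hinj s hs t ht
    (hH.eq_of_dist_eq_zero ((hl _).2 ⟨s, hs, rfl⟩) ((hl _).2 ⟨t, ht, rfl⟩) h)
  le_succ m hm i j hi hj t ht := by
    obtain ⟨e, he, hme⟩ := hQ m hm
    exact hH.dist_le_succ he (hme i hi) (hme j hj) ((hl _).2 ⟨t, ht, rfl⟩)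
  exists_of_eq_succ s hs t ht n h := by
    obtain ⟨e, he, hse, v, hve, hv⟩ := hH.exists_of_dist_eq_succ ((hl _).2 ⟨s, hs, rfl⟩)
      ((hl _).2 ⟨t, ht, rfl⟩) h
    obtain ⟨m, hm, hme⟩ := hE e he
    obtain ⟨j, hj, rfl⟩ := (hl v).1 (mem_vertexSet_of_mem_edgeSet he hve)
    exact ⟨m, hm, hme s hs hse, j, hj, hme j hj hve, hv⟩

/-- Eight vertices of a connected hypergraph can be listed by increasing distance from one of
them, and then their distances form a layer sequence. -/
theorem Reachable.exists_layer (hH : H.Reachable) {S : Finset α} (hS : (S : Set α) = V(H))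
    (hc : S.card = 8) {x : α} (hx : x ∈ S) :
    ∃ τ : Fin 8 → α, Function.Injective τ ∧ (∀ a, a ∈ S ↔ ∃ i, τ i = a) ∧
      ∃ c < 64, ∀ i : Fin 8, H.dist x (τ i) = layer c i := by
  have hS' : ∀ {a}, a ∈ S ↔ a ∈ V(H) := fun {a} => by rw [← hS, Finset.mem_coe]
  let e := S.equivFinOfCardEq hc
  let g : Fin 8 → ℕ := fun i => H.dist x (e.symm i)
  let τ : Fin 8 → α := fun i => e.symm (Tuple.sort g i)
  have hmono : Monotone fun i => H.dist x (τ i) := Tuple.monotone_sort g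
  have hinj : Function.Injective τ :=
    Subtype.val_injective.comp (e.symm.injective.comp (Tuple.sort g).injective)
  have hsurj : ∀ a, a ∈ S ↔ ∃ i, τ i = a := by
    refine fun a => ⟨fun ha => ⟨(Tuple.sort g).symm (e ⟨a, ha⟩), by simp [τ]⟩, ?_⟩
    rintro ⟨i, rfl⟩
    exact (e.symm (Tuple.sort g i)).2
  refine ⟨τ, hinj, hsurj, ?_⟩
  have hmem : ∀ i, τ i ∈ V(H) := fun i => hS'.1 ((hsurj _).2 ⟨i, rfl⟩)
  have hzero : ∀ i, H.dist x (τ i) = 0 → τ i = x := fun i h =>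
    (hH.eq_of_dist_eq_zero (hS'.1 hx) (hmem i) h).symm
  -- The next vertex on a shortest path to `x` is nearer to `x`, hence listed earlier. So the sorted
  -- distances never jump by more than one.
  have hpred : ∀ i, H.dist x (τ i) ≠ 0 → ∃ j < i, H.dist x (τ i) = H.dist x (τ j) + 1 := by
    intro i hi
    obtain ⟨n, hn⟩ := Nat.exists_eq_succ_of_ne_zero hi
    rw [dist_comm] at hn
    obtain ⟨f, hf, -, y, hy, hyn⟩ := hH.exists_of_dist_eq_succ (hmem i) (hS'.1 hx) hn
    obtain ⟨j, rfl⟩ := (hsurj y).1 (hS'.2 (mem_vertexSet_of_mem_edgeSet hf hy))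
    rw [dist_comm] at hn hyn
    refine ⟨j, not_le.1 fun hij => ?_, by omega⟩
    have := hmono hij
    simp only at this
    omega
  have h0 : H.dist x (τ 0) = 0 := by
    by_contra h
    obtain ⟨j, hj, -⟩ := hpred 0 h
    exact absurd hj (Fin.not_lt_zero j)
  have h1 : H.dist x (τ 1) = 1 := by
    obtain ⟨j, hj, hj1⟩ := hpred 1 fun h =>
      absurd (hinj ((hzero 1 h).trans (hzero 0 h0).symm)) (by simp)
    obtain rfl : j = 0 := by omega
    omega
  obtain ⟨c, hc, hcl⟩ := exists_eq_layer (fun i => if h : i < 8 then H.dist x (τ ⟨i, h⟩) else 0)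
    h0 h1 fun i hi => by
      simp only [dif_pos (show i < 8 by omega), dif_pos (show i + 1 < 8 by omega)]
      refine ⟨hmono (Fin.mk_le_mk.2 i.le_succ), ?_⟩
      by_cases h : H.dist x (τ ⟨i + 1, by omega⟩) = 0
      · omega
      · obtain ⟨j, hj, hj1⟩ := hpred _ h
        have := hmono (show j ≤ ⟨i, by omega⟩ from Nat.lt_succ_iff.1 hj)
        simp only at this
        omega
  refine ⟨c, hc, fun i => ?_⟩
  have := hcl i i.2
  rwa [dif_pos i.2] at this

/-- `σ` enumerates the vertex set `V` by the numbers below `9`. -/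
structure IsLabelling (V : Finset α) (σ : ℕ → α) : Prop where
  inj : ∀ i < 9, ∀ j < 9, σ i = σ j → i = j
  mem_iff : ∀ a, a ∈ V ↔ ∃ i < 9, σ i = a

/-- `m` is the mask of a hyperedge, with respect to the labelling `σ` of the vertices. -/
def IsEdgeMask (H : Hypergraph α) (σ : ℕ → α) (m : ℕ) : Prop :=
  m ∈ triples ∧ {a | ∃ i, m.testBit i ∧ σ i = a} ∈ E(H)

/-- The distance between the vertices labelled `s` and `t`, after deletion of that labelled
`u < 9`. -/
noncomputable def labelledDist (H : Hypergraph α) (σ : ℕ → α) (u s t : ℕ) : ℕ :=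
  if u = 9 then H.dist (σ s) (σ t) else (H.deleteVertex (σ u)).dist (σ s) (σ t)

namespace IsLabelling

variable {V : Finset α}

theorem mem (h : IsLabelling V σ) {i : ℕ} (hi : i < 9) : σ i ∈ V := (h.mem_iff _).2 ⟨i, hi, rfl⟩

theorem mem_vertexSet_iff (h : IsLabelling V σ) (hV : (V : Set α) = V(H)) (a : α) :
    a ∈ V(H) ↔ ∃ i < 9, σ i = a := by
  rw [← h.mem_iff, ← hV, Finset.mem_coe]

theorem inj_vertices (h : IsLabelling V σ) (u : ℕ) :
    ∀ s ∈ vertices u, ∀ t ∈ vertices u, σ s = σ t → s = t :=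
  fun s hs t ht => h.inj s (mem_vertices.1 hs).1 t (mem_vertices.1 ht).1

theorem mem_iff_vertices (h : IsLabelling V σ) (a : α) : a ∈ V ↔ ∃ s ∈ vertices 9, σ s = a := by
  simp only [h.mem_iff, mem_vertices]
  exact exists_congr fun i => and_congr_left fun _ => by omega

theorem mem_erase_iff_vertices [DecidableEq α] (h : IsLabelling V σ) {u : ℕ} (hu : u < 9) (a : α) :
    a ∈ V.erase (σ u) ↔ ∃ s ∈ vertices u, σ s = a := by
  rw [Finset.mem_erase, h.mem_iff]
  constructor
  · rintro ⟨hne, i, hi, rfl⟩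
    exact ⟨i, mem_vertices.2 ⟨hi, by rintro rfl; exact hne rfl⟩, rfl⟩
  · rintro ⟨i, hi, rfl⟩
    have hi := mem_vertices.1 hi
    exact ⟨fun he => hi.2 (h.inj i hi.1 u hu he), i, hi.1, rfl⟩

theorem exists_isEdgeMask (h : IsLabelling V σ) (hu : H.IsUniform 3) (hV : (V : Set α) = V(H))
    {e : Set α} (he : e ∈ E(H)) :
    ∃ m, H.IsEdgeMask σ m ∧ ∀ i < 9, m.testBit i ↔ σ i ∈ e := by
  obtain ⟨a, b, d, hab, had, hbd, rfl⟩ := Set.encard_eq_three.1 (hu e he)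
  have hVH := h.mem_vertexSet_iff hV
  obtain ⟨i, hi, rfl⟩ := (hVH a).1 (mem_vertexSet_of_mem_edgeSet he (by simp))
  obtain ⟨j, hj, rfl⟩ := (hVH b).1 (mem_vertexSet_of_mem_edgeSet he (by simp))
  obtain ⟨k, hk, rfl⟩ := (hVH d).1 (mem_vertexSet_of_mem_edgeSet he (by simp))
  have hbit : ∀ n, (2 ^ i ||| 2 ^ j ||| 2 ^ k).testBit n ↔ n = i ∨ n = j ∨ n = k := by
    intro n
    simp only [Nat.testBit_or, Nat.testBit_two_pow, Bool.or_eq_true, decide_eq_true_eq, or_assoc,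
      eq_comm (b := n)]
  refine ⟨2 ^ i ||| 2 ^ j ||| 2 ^ k, ⟨mem_triples hi hj hk (by rintro rfl; exact hab rfl)
    (by rintro rfl; exact had rfl) (by rintro rfl; exact hbd rfl), ?_⟩, fun n hn => ?_⟩
  · have : {a | ∃ n, (2 ^ i ||| 2 ^ j ||| 2 ^ k).testBit n ∧ σ n = a} = {σ i, σ j, σ k} := by
      ext a
      simp only [hbit, Set.mem_ofPred_eq, Set.mem_insert_iff, Set.mem_singleton_iff, or_and_right,
        exists_or, exists_eq_left, eq_comm (a := a)]
    rwa [this]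
  · simp only [hbit, Set.mem_insert_iff, Set.mem_singleton_iff]
    exact or_congr ⟨congrArg σ, h.inj n hn i hi⟩
      (or_congr ⟨congrArg σ, h.inj n hn j hj⟩ ⟨congrArg σ, h.inj n hn k hk⟩)

theorem mem_edgeSet_deleteVertex (h : IsLabelling V σ) {m : ℕ} (hm : H.IsEdgeMask σ m) {u : ℕ}
    (hu : u < 9) (hmu : ¬ m.testBit u) :
    {a | ∃ i, m.testBit i ∧ σ i = a} ∈ E(H.deleteVertex (σ u)) := by
  refine ⟨hm.2, ?_⟩
  rintro ⟨i, hi, hiu⟩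
  exact hmu (h.inj i (lt_nine_of_mem_triples hm.1 hi) u hu hiu ▸ hi)

theorem isDistance (h : IsLabelling V σ) (hu : H.IsUniform 3) (hV : (V : Set α) = V(H))
    (hr : H.Reachable) (hrv : ∀ v ∈ V, (H.deleteVertex v).Reachable) {u : ℕ} (hu9 : u ≤ 9) :
    IsDistance (fun m => H.IsEdgeMask σ m ∧ ¬ m.testBit u) (vertices u) (H.labelledDist σ u) := by
  classical
  rcases Nat.lt_or_eq_of_le hu9 with hu9 | rfl
  · have : H.labelledDist σ u = fun s t => (H.deleteVertex (σ u)).dist (σ s) (σ t) := by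
      funext s t
      exact if_neg hu9.ne
    rw [this]
    refine (hrv _ (h.mem hu9)).isDistance (fun a => ?_) (h.inj_vertices u)
      (fun m hm => ⟨_, h.mem_edgeSet_deleteVertex hm.1 hu9 hm.2, fun i hi => ⟨i, hi, rfl⟩⟩) ?_
    · rw [← h.mem_erase_iff_vertices hu9, vertexSet_deleteVertex, ← hV, ← Finset.coe_erase,
        Finset.mem_coe]
    · rintro e ⟨he, hue⟩
      obtain ⟨m, hm, hme⟩ := h.exists_isEdgeMask hu hV he
      exact ⟨m, ⟨hm, fun hb => hue ((hme u hu9).1 hb)⟩, fun s hs =>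
        (hme s (mem_vertices.1 hs).1).2⟩
  · have : H.labelledDist σ 9 = fun s t => H.dist (σ s) (σ t) := by
      funext s t
      exact if_pos rfl
    rw [this]
    refine hr.isDistance (fun a => ?_) (h.inj_vertices 9)
      (fun m hm => ⟨_, hm.1.2, fun i hi => ⟨i, hi, rfl⟩⟩) ?_
    · rw [← h.mem_iff_vertices, ← hV, Finset.mem_coe]
    · rintro e he
      obtain ⟨m, hm, hme⟩ := h.exists_isEdgeMask hu hV he
      -- Bit 9 is never set in the mask of a triple, so for `u = 9` the avoidance condition holds
      -- automatically.
      exact ⟨m, ⟨hm, fun hb => absurd (lt_nine_of_mem_triples hm.1 hb) (by norm_num)⟩,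
        fun s hs => (hme s (mem_vertices.1 hs).1).2⟩

theorem sum_vertices [DecidableEq α] (h : IsLabelling V σ) {u : ℕ} (hu : u < 9) (f : α → ℕ) :
    ((vertices u).map fun s => f (σ s)).sum = ∑ a ∈ V.erase (σ u), f a :=
  sum_map_eq_sum (nodup_vertices u) (h.inj_vertices u) (h.mem_erase_iff_vertices hu) f

theorem sum_labelledDist (h : IsLabelling V σ) (hV : (V : Set α) = V(H)) (hr : H.Reachable)
    (hrv : ∀ v ∈ V, (H.deleteVertex v).Reachable) {w : ℕ} (hw : H.wienerIndex = w)
    (hwv : ∀ v ∈ V, (H.deleteVertex v).wienerIndex = w) {u : ℕ} (hu : u ≤ 9) :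
    ((vertices u).map fun s => ((vertices u).map fun t => H.labelledDist σ u s t).sum).sum =
      2 * w := by
  classical
  rcases Nat.lt_or_eq_of_le hu with hu | rfl
  · simp only [labelledDist, if_neg hu.ne]
    have hrow : ∀ a, ((vertices u).map fun t => (H.deleteVertex (σ u)).dist a (σ t)).sum = _ :=
      fun a => h.sum_vertices hu fun b => (H.deleteVertex (σ u)).dist a b
    simp only [hrow]
    rw [h.sum_vertices hu fun a => ∑ b ∈ V.erase (σ u), (H.deleteVertex (σ u)).dist a b]
    exact (hrv _ (h.mem hu)).sum_dist _ (by simp [hV]) (hwv _ (h.mem hu))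
  · have hsum := fun f : α → ℕ =>
      sum_map_eq_sum (nodup_vertices 9) (h.inj_vertices 9) h.mem_iff_vertices f
    simp only [labelledDist, if_true]
    have hrow : ∀ a, ((vertices 9).map fun t => H.dist a (σ t)).sum = _ :=
      fun a => hsum fun b => H.dist a b
    simp only [hrow]
    rw [hsum fun a => ∑ b ∈ V, H.dist a b]
    exact hr.sum_dist _ hV hw

end IsLabelling

theorem excess_le_two (huni : H.IsUniform 3) {V : Finset α} (hV : (V : Set α) = V(H))
    (hc : V.card = 9) (hr : H.Reachable) (hrv : ∀ v ∈ V, (H.deleteVertex v).Reachable) {w : ℕ}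
    (hw : H.wienerIndex = w) (hwv : ∀ v ∈ V, (H.deleteVertex v).wienerIndex = w) {v : α}
    (hv : v ∈ V) : excess H V v ≤ 2 ∧ (0 < excess H V v → 47 ≤ w) := by
  classical
  rcases Nat.eq_zero_or_pos (excess H V v) with h0 | hpos
  · simp [h0]
  set G := H.deleteVertex v with hG
  have hVv : ((V.erase v : Finset α) : Set α) = V(G) := by simp [hG, hV]
  have hcv : (V.erase v).card = 8 := by rw [Finset.card_erase_of_mem hv, hc]
  -- Maximality of the row excess of `x` is what the leaves `wide` contradict; it also ensures that
  -- `x` itself sees a distance of at least 4.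
  obtain ⟨x, hx, hmax⟩ := (V.erase v).exists_max_image
    (fun s => ∑ t ∈ V.erase v, (G.dist s t - 3)) (Finset.card_pos.1 (by omega))
  obtain ⟨τ, hτ, hτV, c, hc64, hτc⟩ := (hrv v hv).exists_layer hVv hcv hx
  -- The deleted vertex gets label 8, and `x` gets label 0, being the only vertex at distance 0.
  let σ : ℕ → α := fun i => if h : i < 8 then τ ⟨i, h⟩ else v
  have hσ8 : σ 8 = v := rfl
  have hσ : ∀ i (h : i < 8), σ i = τ ⟨i, h⟩ := fun i h => dif_pos h
  have hτv : ∀ i, τ i ≠ v := fun i => Finset.ne_of_mem_erase ((hτV _).2 ⟨i, rfl⟩)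
  have hinj : ∀ i < 9, ∀ j < 9, σ i = σ j → i = j := by
    intro i hi j hj h
    rcases Nat.lt_succ_iff_lt_or_eq.1 hi with hi | rfl <;>
      rcases Nat.lt_succ_iff_lt_or_eq.1 hj with hj | rfl
    · rw [hσ i hi, hσ j hj] at h
      exact Fin.mk.inj_iff.1 (hτ h)
    · rw [hσ i hi, hσ8] at h
      exact absurd h (hτv _)
    · rw [hσ j hj, hσ8] at h
      exact absurd h.symm (hτv _)
    · rfl
  have hσV : ∀ a, a ∈ V ↔ ∃ i < 9, σ i = a := by
    intro a
    constructor
    · intro ha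
      by_cases hav : a = v
      · exact ⟨8, by norm_num, hav ▸ hσ8⟩
      · obtain ⟨i, rfl⟩ := (hτV a).1 (Finset.mem_erase.2 ⟨hav, ha⟩)
        exact ⟨i, by omega, hσ i i.2⟩
    · rintro ⟨i, hi, rfl⟩
      rcases Nat.lt_succ_iff_lt_or_eq.1 hi with hi | rfl
      · rw [hσ i hi]
        exact Finset.mem_of_mem_erase ((hτV _).2 ⟨_, rfl⟩)
      · exact hv
  have hL : IsLabelling V σ := ⟨hinj, hσV⟩
  have hDist := fun u hu => hL.isDistance (u := u) huni hV hr hrv hu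
  have hW := fun u hu => hL.sum_labelledDist (u := u) hV hr hrv hw hwv hu
  have hD8 : ∀ s t, H.labelledDist σ 8 s t = G.dist (σ s) (σ t) := fun s t => if_neg (by norm_num)
  have hrow : ∀ s, ((vertices 8).map fun t => H.labelledDist σ 8 s t - 3).sum =
      ∑ t ∈ V.erase v, (G.dist (σ s) t - 3) := by
    intro s
    simp only [hD8]
    exact hL.sum_vertices (u := 8) (by norm_num) fun b => G.dist (σ s) b - 3
  have hex : ((vertices 8).map fun s => ((vertices 8).map fun t => H.labelledDist σ 8 s t - 3).sum).sum =
      excess H V v := by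
    simp only [hrow]
    exact hL.sum_vertices (u := 8) (by norm_num) fun a => ∑ t ∈ V.erase v, (G.dist a t - 3)
  have hlayer : ∑ t ∈ V.erase v, (G.dist x t - 3) = layerExcess c := by
    rw [layerExcess, ← hσ8, ← hL.sum_vertices (u := 8) (by norm_num) fun b => G.dist x b - 3]
    refine congrArg List.sum (List.map_congr_left fun i hi => ?_)
    have hi8 : i < 8 := by
      have := mem_vertices.1 hi
      omega
    rw [hσ i hi8, hτc ⟨i, hi8⟩]
  have hρ : ∀ s ∈ vertices 8, ((vertices 8).map fun t => H.labelledDist σ 8 s t - 3).sum ≤ layerExcess c := by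
    intro s hs
    rw [hrow, ← hlayer]
    exact hmax _ ((hL.mem_erase_iff_vertices (u := 8) (by norm_num) _).2 ⟨s, hs, rfl⟩)
  -- If the last, hence largest, distance from `x` were at most 3, the largest row excess would be
  -- 0, contradicting the positive total.
  have h4 : 4 ≤ layer c 7 := by
    by_contra! h
    refine hpos.ne' (Finset.sum_eq_zero fun s hs => Nat.le_zero.1 ((hmax s hs).trans ?_))
    rw [hlayer, layerExcess, Nat.le_zero]
    refine List.sum_eq_zero fun n hn => ?_
    obtain ⟨i, hi, rfl⟩ := List.mem_map.1 hn
    have hi := mem_vertices.1 hi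
    have := layer_le_layer c (show i ≤ 7 by omega)
    omega
  have hlayered : ∀ m, H.IsEdgeMask σ m → m ∈ layered c := by
    intro m hm
    refine List.mem_filter.2 ⟨hm.1, ?_⟩
    simp only [mem_eq_testBit]
    by_cases h8 : m.testBit 8
    · simp [h8]
    · simp only [h8, Bool.false_or, List.all_eq_true, List.mem_range, Bool.or_eq_true,
        Bool.not_eq_true', ← Bool.not_eq_true]
      refine fun i hi => or_iff_not_imp_left.2 fun hmi j hj => or_iff_not_imp_left.2 fun hmj => ?_
      -- A hyperedge without label 8 survives the deletion, so distances from `x` differ by at most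
      -- one on it.
      have hE := hL.mem_edgeSet_deleteVertex hm (u := 8) (by norm_num) h8
      have hle := (hrv v hv).dist_le_succ hE ⟨i, not_not.1 hmi, rfl⟩ ⟨j, not_not.1 hmj, rfl⟩
        (hVv ▸ Finset.mem_coe.2 hx)
      rw [dist_comm, dist_comm (σ j), hσ i hi, hσ j hj, hτc, hτc] at hle
      exact Nat.ble_eq_true_of_le hle
  refine ⟨?_, fun _ => ?_⟩
  · by_contra! h3
    have := Refutation.not_check hDist hW hρ (hex ▸ h3) (refutation c) (es := []) (by simp) hlayered
    rw [check_refutation c hc64 h4] at this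
    exact absurd this (by simp)
  · have hav : ∀ e, H.IsEdgeMask σ e ∧ ¬ e.testBit 8 → e ∈ avoid 8 (layered c) := fun e he =>
      List.mem_filter.2 ⟨hlayered e he.1, by simpa [mem_eq_testBit] using he.2⟩
    have hd := (hDist 8 (by norm_num)).not_disconnects hav 5
    have ht := (hDist 8 (by norm_num)).totalSum_le hav 0 4
    simp only [Nat.sub_zero] at ht
    rw [hW 8 (by norm_num)] at ht
    rcases layered_disconnects_or_le c hc64 h4 with h | h
    · rw [hd] at h
      exact absurd h (by simp)
    · omega

end Hypergraph

/-! ### Conclusion. -/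

theorem mainTheorem3 {α : Type*} :
    ¬ ∃ H : Hypergraph α, H.IsUniform 3 ∧ H.vertexSet.encard = 9 ∧ H.IsSoltes := by
  rintro ⟨H, hu, hcard, hfin, ⟨-, hr⟩, hS⟩
  have hr : H.Reachable := hr
  obtain ⟨V, hV⟩ : ∃ V : Finset α, (V : Set α) = H.vertexSet := ⟨hfin.toFinset, hfin.coe_toFinset⟩
  have hc : V.card = 9 := by
    rw [← hV, Set.encard_coe_eq_coe_finsetCard] at hcard
    exact_mod_cast hcard
  have hmem : ∀ v ∈ V, v ∈ H.vertexSet := fun v hv => hV ▸ Finset.mem_coe.2 hv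
  obtain ⟨w, hw⟩ := ENat.ne_top_iff_exists.1 (Hypergraph.wienerIndex_ne_top hfin hr)
  have hwv : ∀ v ∈ V, (H.deleteVertex v).wienerIndex = w := fun v hv =>
    (hS v (hmem v hv)).trans hw.symm
  have hrv : ∀ v ∈ V, (H.deleteVertex v).Reachable := fun v hv =>
    Hypergraph.reachable_of_wienerIndex_ne_top (hfin.subset Set.sdiff_subset)
      (hwv v hv ▸ ENat.natCast_ne_top w)
  obtain ⟨hle, hpos⟩ := Hypergraph.two_mul_le_sum_excess hu hV hc hr hrv hw.symm hwv
  have hex := fun v hv => Hypergraph.excess_le_two hu hV hc hr hrv hw.symm hwv (v := v) hv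
  obtain ⟨v, hv, hv0⟩ : ∃ v ∈ V, 0 < H.excess V v := by
    by_contra! h
    exact hpos.ne' (Finset.sum_eq_zero fun v hv => Nat.le_zero.1 (h v hv))
  have h47 := (hex v hv).2 hv0
  have h18 : ∑ v ∈ V, H.excess V v ≤ _ := Finset.sum_le_card_nsmul V _ 2 fun v hv => (hex v hv).1
  rw [hc, smul_eq_mul] at h18
  -- `2 * w ≤ 72 + 18 = 90`, against `2 * w ≥ 94`.
  omega
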